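/- **Proposition.** The verification problem $\mathsf{Reach}(\mathcal M,m,\mathcal G,F)$ defined below is undecidable: there is no algorithm (computable function) which, given (a standard encoding by tuples and lists of natural numbers of) a finite-state machine $\mathcal M$, a number $m$ of copies of it, a series-parallel graph grammar $\mathcal G$ and a configuration property $F$, decides whether $\mathsf{Reach}(\mathcal M,m,\mathcal G,F)$ has a positive answer. (No bound is imposed on the number of reversals of the machines or on the number of registers.) *Graphs.* For a label set $L$, an $L$-labelled graph is $G=(N,E,n_b,n_e)$ with $N$ a finite set of nodes, $E$ a finite multiset of edges $(n,n',\ell)\in N\times N\times L$, and $n_b,n_e\in N$ (source and sink). For an edge $e=(n,n',\ell)$ of $G$ and a graph $G'$ whose nodes are disjoint from those of $G$, $G[e\mapsto G']$ is obtained by removing one copy of $e$ from $G$ and adding the nodes and edges of $G'$, with the source of $G'$ fused with $n$ and the sink of $G'$ fused with $n'$. *Grammars.* A series-parallel graph grammar $\mathcal G=(V,\Sigma,R,G_0)$ has finite disjoint sets $V$ (variables) and $\Sigma$ (letters), an initial graph $G_0$ consisting of two distinct nodes, the source and the sink, and a single edge from source to sink labelled by a variable $v_0$, and a finite set $R$ of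 rules $(v,G')$ with $v\in V$, where $G'$ has distinct source $n_b$ and sink $n_e$ and is of one of three forms: (1) nodes $n_b,n_e$ and the single edge $(n_b,n_e,\sigma)$, $\sigma\in\Sigma$; (2) three nodes $n_b,n',n_e$ and edges $(n_b,n',v_1),(n',n_e,v_2)$ with $v_1,v_2\in V$; (3) nodes $n_b,n_e$ and the two parallel edges $(n_b,n_e,v_1),(n_b,n_e,v_2)$ with $v_1,v_2\in V$. A derivation step replaces an edge labelled $v$ by a fresh copy of $G'$ for some rule $(v,G')\in R$. A $\Sigma$-labelled graph is derived by $\mathcal G$ if it is obtained from $G_0$ by finitely many steps. $\mathcal L^u(\mathcal G)$ is the set of symmetric closures of derived graphs, where the symmetric closure replaces every edge $(n,n',\sigma)$ by the two edges $(n,n',(\sigma,1))$ and $(n',n,(\sigma,-1))$. *Machines.* $\mathcal M=(Q,q^0,\Sigma,\delta)$ has a finite set $Q$ of states, $q^0\in Q$, and $\delta\subseteq Q\times(\Sigma\times\{1,-1\})\times\{0,1\}\times Q\times\{0,1\}$. A configuration $\langle G,\mu,\beta\rangle$ of $m$ copies of $\mathcal M$ consists of a graph $G\in\mathcal L^u(\mathcal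 G)$ with node set $N$, a map $\mu:N\to 2^{\{1,\dots,m\}\times Q}$ such that for each $i$ there is exactly one pair $(n,q)$ with $(i,q)\in\mu(n)$, and a register valuation $\beta:N\to\{0,1\}$. It is initial if $\mu(n_b)=\{(i,q^0)\mid 1\le i\le m\}$, $\mu(n)=\emptyset$ for $n\ne n_b$, and $\beta\equiv 0$. There is a step $\langle G,\mu,\beta\rangle\to\langle G,\mu',\beta'\rangle$ if there are $i\in\{1,\dots,m\}$, an edge $(n,n',(\sigma,d))$ of $G$ and $(q,(\sigma,d),\beta(n),q',b')\in\delta$ such that $(i,q)\in\mu(n)$, $\mu'(n)=\mu(n)\setminus\{(i,q)\}$, $\mu'(n')=\mu(n')\cup\{(i,q')\}$, $\beta'(n)=b'$, and $\mu',\beta'$ agree with $\mu,\beta$ on all other nodes ($\beta'(n')=\beta(n')$ included). A run is a finite nonempty sequence of configurations that begins with an initial one and in which consecutive configurations are related by $\to$. *Properties.* Configuration properties are the positive Boolean combinations (conjunctions and disjunctions) of atoms $\exists n.\ S\preceq\mu(n)$, with $S:Q\to\mathbb N$ a multiset of states. The atom holds in $\langle G,\mu,\beta\rangle$ if some node $n$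 satisfies $S(q)\le|\{i\mid(i,q)\in\mu(n)\}|$ for all $q\in Q$. *Problem.* $\mathsf{Reach}(\mathcal M,m,\mathcal G,F)$ asks whether there is a run, over some graph in $\mathcal L^u(\mathcal G)$, that contains a configuration satisfying $F$. -/

import Mathlib

/-- A graph with edges labelled in `L`: a finite set of nodes (named by natural numbers), a finite
multiset of labelled directed edges `(n, n', l)`, a source and a sink. -/
structure LGraph (L : Type) where
  nodes : Finset ℕ
  edges : Multiset (ℕ × ℕ × L)
  source : ℕ
  sink : ℕ
  source_mem : source ∈ nodes
  sink_mem : sink ∈ nodes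
  edges_mem : ∀ e ∈ edges, e.1 ∈ nodes ∧ e.2.1 ∈ nodes

namespace LGraph

variable {L L' : Type}

/-- Relabelling of the edges. -/
def mapLabels (f : L → L') (G : LGraph L) : LGraph L' where
  nodes := G.nodes
  edges := G.edges.map fun e => (e.1, e.2.1, f e.2.2)
  source := G.source
  sink := G.sink
  source_mem := G.source_mem
  sink_mem := G.sink_mem
  edges_mem := by
    intro e he
    obtain ⟨e', he', rfl⟩ := Multiset.mem_map.1 he
    exact G.edges_mem e' he'

/-- The fusion of nodes performed when the graph `H` is substituted for the edge `e`: the source of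
`H` becomes the source of `e`, the sink of `H` becomes the target of `e`. -/
def fuse (e : ℕ × ℕ × L) (H : LGraph L) (x : ℕ) : ℕ :=
  if x = H.source then e.1 else if x = H.sink then e.2.1 else x

/-- Edge replacement `G[e ↦ H]` (used for graphs `G`, `H` on disjoint sets of nodes): one copy of
the edge `e` is removed from `G`, and `H` is added with its source and sink fused with the
endpoints of `e`. -/
def replaceEdge [DecidableEq L] (G : LGraph L) (e : ℕ × ℕ × L) (he : e ∈ G.edges)
    (H : LGraph L) : LGraph L where
  nodes := G.nodes ∪ (H.nodes \ {H.source, H.sink})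
  edges := G.edges.erase e + H.edges.map fun a => (fuse e H a.1, fuse e H a.2.1, a.2.2)
  source := G.source
  sink := G.sink
  source_mem := Finset.mem_union_left _ G.source_mem
  sink_mem := Finset.mem_union_left _ G.sink_mem
  edges_mem := by
    have key : ∀ x ∈ H.nodes, fuse e H x ∈ G.nodes ∪ (H.nodes \ {H.source, H.sink}) := by
      intro x hx
      unfold fuse
      have h1 := G.edges_mem e he
      split_ifs with h h' <;> simp_all
    intro a ha
    rcases Multiset.mem_add.1 ha with ha | ha
    · have := G.edges_mem a (Multiset.mem_of_mem_erase ha)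
      exact ⟨Finset.mem_union_left _ this.1, Finset.mem_union_left _ this.2⟩
    · obtain ⟨b, hb, rfl⟩ := Multiset.mem_map.1 ha
      exact ⟨key _ (H.edges_mem b hb).1, key _ (H.edges_mem b hb).2⟩

end LGraph

/-- The two directions `1` and `-1` in which an edge can be traversed. -/
inductive Dir where
  | fwd
  | bwd

namespace LGraph

variable {L : Type}

/-- The symmetric closure: every edge `(n, n', l)` gives the edges `(n, n', (l, 1))` and
`(n', n, (l, -1))`. -/
def symmClosure (G : LGraph L) : LGraph (L × Dir) where
  nodes := G.nodes
  edges := G.edges.map (fun e => (e.1, e.2.1, (e.2.2, Dir.fwd))) +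
    G.edges.map (fun e => (e.2.1, e.1, (e.2.2, Dir.bwd)))
  source := G.source
  sink := G.sink
  source_mem := G.source_mem
  sink_mem := G.sink_mem
  edges_mem := by
    intro a ha
    rcases Multiset.mem_add.1 ha with ha | ha
    · obtain ⟨b, hb, rfl⟩ := Multiset.mem_map.1 ha
      exact G.edges_mem b hb
    · obtain ⟨b, hb, rfl⟩ := Multiset.mem_map.1 ha
      exact (G.edges_mem b hb).symm

end LGraph

/-- The three kinds of right-hand sides of rules: a single terminal edge, a series composition
`v₁ · v₂`, a parallel composition `v₁ ∥ v₂`. -/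
inductive SPRhs (V A : Type) where
  | terminal (a : A)
  | series (v₁ v₂ : V)
  | parallel (v₁ v₂ : V)

/-- `rhs.IsGraph H`: the graph `H` is a copy of the right-hand side `rhs`. -/
def SPRhs.IsGraph {V A : Type} : SPRhs V A → LGraph (A ⊕ V) → Prop
  | .terminal a, H => H.source ≠ H.sink ∧ H.nodes = {H.source, H.sink} ∧
      H.edges = {(H.source, H.sink, Sum.inl a)}
  | .series v₁ v₂, H => H.source ≠ H.sink ∧ ∃ n, n ≠ H.source ∧ n ≠ H.sink ∧
      H.nodes = {H.source, H.sink, n} ∧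
      H.edges = {(H.source, n, Sum.inr v₁), (n, H.sink, Sum.inr v₂)}
  | .parallel v₁ v₂, H => H.source ≠ H.sink ∧ H.nodes = {H.source, H.sink} ∧
      H.edges = {(H.source, H.sink, Sum.inr v₁), (H.source, H.sink, Sum.inr v₂)}

/-- A series-parallel graph grammar with variables `V` and alphabet `A` (both finite in use):
a set of rules and the variable `v₀` labelling the single edge of the initial graph. -/
structure SPGG (V A : Type) where
  rules : Set (V × SPRhs V A)
  start : V

namespace SPGG

variable {V A : Type}

/-- The initial graph: two distinct nodes joined by one edge labelled with the start variable. -/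
def initialGraph (𝒢 : SPGG V A) : LGraph (A ⊕ V) where
  nodes := {0, 1}
  edges := {(0, 1, Sum.inr 𝒢.start)}
  source := 0
  sink := 1
  source_mem := by simp
  sink_mem := by simp
  edges_mem := by simp

/-- One derivation step: an edge labelled with a variable `v` is replaced by a copy, on fresh
nodes, of the right-hand side of a rule for `v`. -/
def Step [DecidableEq V] [DecidableEq A] (𝒢 : SPGG V A) (G G'' : LGraph (A ⊕ V)) : Prop :=
  ∃ (n n' : ℕ) (v : V) (he : (n, n', Sum.inr v) ∈ G.edges) (rhs : SPRhs V A)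
    (H : LGraph (A ⊕ V)),
    (v, rhs) ∈ 𝒢.rules ∧ rhs.IsGraph H ∧ Disjoint G.nodes H.nodes ∧
      G'' = G.replaceEdge (n, n', Sum.inr v) he H

/-- The graphs labelled with terminal letters only that are derived by the grammar. -/
def language [DecidableEq V] [DecidableEq A] (𝒢 : SPGG V A) : Set (LGraph A) :=
  {G | Relation.ReflTransGen 𝒢.Step 𝒢.initialGraph (G.mapLabels Sum.inl)}

/-- The symmetric closures of the derived graphs. -/
def symmLanguage [DecidableEq V] [DecidableEq A] (𝒢 : SPGG V A) : Set (LGraph (A × Dir)) :=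
  LGraph.symmClosure '' 𝒢.language

end SPGG

/-- A finite-state machine with states `Q` and alphabet `A` (both finite in use). A transition
`(q, (a, d), b, q', b')` in state `q`, on register value `b`, moves along an edge labelled
`(a, d)` to state `q'` and writes `b'` to the register at the node that is left. -/
structure FSM (Q A : Type) where
  init : Q
  trans : Set (Q × (A × Dir) × Bool × Q × Bool)

/-- Configurations of `m` machines with states `Q` over a fixed graph `G`: the machine states
present at each node, where every machine is in exactly one node and one state, and the Boolean
register at each node. -/
@[ext]
structure Config {A : Type} (G : LGraph (A × Dir)) (m : ℕ) (Q : Type) where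
  μ : G.nodes → Set (Fin m × Q)
  β : G.nodes → Bool
  existsUnique_state : ∀ i : Fin m, ∃! p : G.nodes × Q, (i, p.2) ∈ μ p.1

namespace Config

variable {Q A : Type} {G : LGraph (A × Dir)} {m : ℕ}

/-- All machines are at the source in their initial state, and all registers are `0`. -/
def IsInitial (M : FSM Q A) (γ : Config G m Q) : Prop :=
  γ.μ ⟨G.source, G.source_mem⟩ = {p | p.2 = M.init} ∧
    (∀ n : G.nodes, (n : ℕ) ≠ G.source → γ.μ n = ∅) ∧ ∀ n, γ.β n = false

/-- Machine `i` makes a transition. -/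
def StepBy (M : FSM Q A) (i : Fin m) (γ γ' : Config G m Q) : Prop :=
  ∃ (n n' : G.nodes) (l : A × Dir) (q q' : Q) (b' : Bool),
    ((n : ℕ), (n' : ℕ), l) ∈ G.edges ∧
    (i, q) ∈ γ.μ n ∧
    (q, l, γ.β n, q', b') ∈ M.trans ∧
    γ'.μ n = γ.μ n \ {(i, q)} ∧ γ'.μ n' = γ.μ n' ∪ {(i, q')} ∧
    (∀ n'', n'' ≠ n → n'' ≠ n' → γ'.μ n'' = γ.μ n'') ∧
    γ'.β n = b' ∧ ∀ n'', n'' ≠ n → γ'.β n'' = γ.β n''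

/-- The successor relation (a step of some machine; the graph does not change). -/
def Step (M : FSM Q A) (γ γ' : Config G m Q) : Prop :=
  ∃ i, StepBy M i γ γ'

/-- Runs over `G`: nonempty finite sequences of configurations that start in an initial
configuration and follow the successor relation. -/
def IsRun (M : FSM Q A) (ρ : List (Config G m Q)) : Prop :=
  (∃ γ₀ ∈ ρ.head?, IsInitial M γ₀) ∧ ρ.IsChain (Step M)

end Config

/-- Configuration properties: positive Boolean combinations of atoms `∃ n. S ≼ μ(n)`, where `S` is
a multiset over `Q`, given by its multiplicities. -/
inductive ConfigProperty (Q : Type) where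
  | atom (S : Q → ℕ)
  | and (F₁ F₂ : ConfigProperty Q)
  | or (F₁ F₂ : ConfigProperty Q)

/-- Satisfaction of a configuration property. -/
def ConfigProperty.Sat {Q A : Type} {G : LGraph (A × Dir)} {m : ℕ} (γ : Config G m Q) :
    ConfigProperty Q → Prop
  | .atom S => ∃ n, ∀ q, S q ≤ {i : Fin m | (i, q) ∈ γ.μ n}.ncard
  | .and F₁ F₂ => F₁.Sat γ ∧ F₂.Sat γ
  | .or F₁ F₂ => F₁.Sat γ ∨ F₂.Sat γ

/-- `Reach M m 𝒢 F`: some run of `m` copies of `M` on some graph derived by `𝒢` visits a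
configuration that satisfies `F`. -/
def Reach {Q V A : Type} [DecidableEq V] [DecidableEq A]
    (M : FSM Q A) (m : ℕ) (𝒢 : SPGG V A) (F : ConfigProperty Q) : Prop :=
  ∃ G ∈ 𝒢.symmLanguage, ∃ ρ : List (Config G m Q), Config.IsRun M ρ ∧ ∃ γ ∈ ρ, F.Sat γ

/-! ### Instances of the verification problem as inputs of algorithms

The finite sets of states, letters and variables are taken to be initial segments of `ℕ`. -/

/-- An instance `(M, m, 𝒢, F)` of the verification problem. -/
structure ReachInstance where
  numStates : ℕ
  numLetters : ℕ
  numVars : ℕ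
  machine : FSM (Fin numStates) (Fin numLetters)
  m : ℕ
  grammar : SPGG (Fin numVars) (Fin numLetters)
  final : ConfigProperty (Fin numStates)

/-- The question asked by an instance. -/
def ReachInstance.Holds (I : ReachInstance) : Prop :=
  Reach I.machine I.m I.grammar I.final

/-- Codes of directions. -/
def Dir.code : Dir → Bool
  | .fwd => true
  | .bwd => false

/-- Codes of right-hand sides. -/
def SPRhs.code {v a : ℕ} : SPRhs (Fin v) (Fin a) → ℕ ⊕ (ℕ × ℕ) ⊕ (ℕ × ℕ)
  | .terminal x => .inl x
  | .series v₁ v₂ => .inr (.inl (v₁, v₂))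
  | .parallel v₁ v₂ => .inr (.inr (v₁, v₂))

/-- Codes of rules. -/
def ruleCode {v a : ℕ} (r : Fin v × SPRhs (Fin v) (Fin a)) : ℕ × (ℕ ⊕ (ℕ × ℕ) ⊕ (ℕ × ℕ)) :=
  (r.1, r.2.code)

/-- Codes of transitions. -/
def transCode {s a : ℕ} (t : Fin s × (Fin a × Dir) × Bool × Fin s × Bool) :
    ℕ × (ℕ × Bool) × Bool × ℕ × Bool :=
  (t.1, (t.2.1.1, t.2.1.2.code), t.2.2.1, t.2.2.2.1, t.2.2.2.2)

/-- Codes of configuration properties, in prefix notation: `inl l` stands for the atom with list of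
multiplicities `l`, `inr true` for conjunction and `inr false` for disjunction. -/
def ConfigProperty.code {s : ℕ} : ConfigProperty (Fin s) → List (List ℕ ⊕ Bool)
  | .atom S => [.inl (List.ofFn S)]
  | .and F₁ F₂ => .inr true :: (F₁.code ++ F₂.code)
  | .or F₁ F₂ => .inr false :: (F₁.code ++ F₂.code)

/-- Codes of instances: the numbers of states, letters and variables; the initial state and a list
of the transitions; the number of machines; the start variable and a list of the rules; the
configuration property. -/
abbrev ReachCode : Type :=
  (ℕ × ℕ × ℕ) × (ℕ × List (ℕ × (ℕ × Bool) × Bool × ℕ × Bool)) × ℕ ×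
    (ℕ × List (ℕ × (ℕ ⊕ (ℕ × ℕ) ⊕ (ℕ × ℕ)))) × List (List ℕ ⊕ Bool)

/-- `c` is a code of the instance `I`: the finite sets of transitions and of rules may be listed
in any order. -/
def ReachInstance.IsCode (I : ReachInstance) (c : ReachCode) : Prop :=
  ∃ (ts : List (Fin I.numStates × (Fin I.numLetters × Dir) × Bool × Fin I.numStates × Bool))
    (rs : List (Fin I.numVars × SPRhs (Fin I.numVars) (Fin I.numLetters))),
    (∀ t, t ∈ ts ↔ t ∈ I.machine.trans) ∧ (∀ r, r ∈ rs ↔ r ∈ I.grammar.rules) ∧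
    c = ((I.numStates, I.numLetters, I.numVars), ((I.machine.init : ℕ), ts.map transCode), I.m,
      ((I.grammar.start : ℕ), rs.map ruleCode), I.final.code)

/-!
The halting problem reduces to the verification problem, already for one machine (`m = 1`) and a
grammar with one variable and one letter. The rules `S → S · S` and `S → a` derive exactly the
directed paths, and on a path the registers of the nodes form a tape of bits on which the machine
is the head. A halting computation of a Turing machine uses a bounded part of its tape only, so
it fits on a sufficiently long path; conversely a machine that leaves no room on the path is merely
stuck, because there is no edge to be taken, and does not reach any wrong state.

The Turing machine is a fixed one over the alphabet `Bool` whose halting problem is undecidable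
(`exists_undecidable_finTM`), obtained from the translations of partial recursive functions to
Turing machines in Mathlib. The instance for an input word `l` (`simMachine`) guesses how far to
walk away from the source, writes `l` from right to left into the registers by means of
`l.length + 1` additional states, and then simulates the Turing machine until it halts. Only this
loading part depends on `l`, which makes the code of the instance a primitive recursive function
of `l` (`primrec_haltCode`): the remaining transitions are a fixed finite list.

Soundness (`dom_of_reach`) rests on the invariant `SimInv` of runs. For it, only the existence of an
injective assignment of integers to the nodes is needed, under which every edge leads from a level
to the next one (`exists_levels_of_mem_symmLanguage`); such an assignment is maintained along
derivations. Completeness (`reach_of_dom`) uses explicit paths (`exists_path_mem_symmLanguage`)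
and an induction on the length of the halting computation (`canHalt_run`).
-/

/-! ### A Turing machine with an undecidable halting problem -/

open Turing in
/-- A Turing machine that uses finitely many states only can be renumbered to have the states
`Fin (N + 1)`. -/
theorem exists_finTM {Λ : Type} [Inhabited Λ] (M : TM0.Machine Bool Λ) (S : Finset Λ)
    (hS : TM0.Supports M (S : Set Λ)) :
    ∃ (N : ℕ) (T : TM0.Machine Bool (Fin (N + 1))) (q₀ : Fin (N + 1)), ∀ l : List Bool,
      (StateTransition.eval (TM0.step T) ⟨q₀, Tape.mk₁ l⟩).Dom ↔ (TM0.eval M l).Dom := by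
  classical
  obtain ⟨N, hN⟩ : ∃ N, S.card = N + 1 :=
    Nat.exists_eq_succ_of_ne_zero (Finset.card_ne_zero_of_mem hS.1)
  let e : S ≃ Fin (N + 1) := S.equivFinOfCardEq hN
  let T : TM0.Machine Bool (Fin (N + 1)) := fun i a =>
    (M (e.symm i) a).bind fun p => if h : p.1 ∈ S then some (e ⟨p.1, h⟩, p.2) else none
  have key : StateTransition.Respects (TM0.step M) (TM0.step T)
      fun c₁ c₂ => c₁.q = e.symm c₂.q ∧ c₁.Tape = c₂.Tape := by
    rintro ⟨q, t⟩ ⟨i, t'⟩ ⟨h1, h2⟩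
    dsimp at h1 h2
    subst h1 h2
    rcases hM : M (e.symm i) t.head with _ | ⟨q', s⟩
    · simp [TM0.step, T, hM]
    · have hq' : q' ∈ S := hS.2 hM (e.symm i).2
      simp only [TM0.step, hM, Option.map_some]
      refine ⟨⟨e ⟨q', hq'⟩, _⟩, ⟨by simp, rfl⟩, Relation.TransGen.single ?_⟩
      simp [TM0.step, T, hM, hq']
  refine ⟨N, T, e ⟨default, hS.1⟩, fun l => ?_⟩
  refine (StateTransition.tr_eval_dom key (a₁ := TM0.init l) ⟨?_, rfl⟩).trans Iff.rfl
  simp [TM0.init]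

open Turing in
theorem trNat_two_pow (k : ℕ) : PartrecToTM2.trNat (2 ^ k) =
    List.replicate k PartrecToTM2.Γ'.bit0 ++ [PartrecToTM2.Γ'.bit1] := by
  have key : ∀ k : ℕ, ∃ p : PosNum, ((2 ^ k : ℕ) : Num) = Num.pos p ∧ PartrecToTM2.trPosNum p =
      List.replicate k PartrecToTM2.Γ'.bit0 ++ [PartrecToTM2.Γ'.bit1] := by
    intro k
    induction k with
    | zero => exact ⟨PosNum.one, by simp; rfl, rfl⟩
    | succ k ih =>
      obtain ⟨p, hp, h⟩ := ih
      refine ⟨p.bit0, ?_, ?_⟩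
      · have : ((2 ^ (k + 1) : ℕ) : Num) = (2 ^ k : ℕ) + (2 ^ k : ℕ) := by
          rw [← Nat.cast_add]; congr 1; ring
        rw [this, hp, Num.bit0_of_bit0]
        rfl
      · simp [PartrecToTM2.trPosNum, h, List.replicate_succ]
  obtain ⟨p, hp, h⟩ := key k
  rw [PartrecToTM2.trNat, hp, ← h]; rfl

open Turing in
/-- The chain of translations from partial recursive codes to stack machines, to Turing machines
over a large alphabet, to Turing machines over `Bool`. The inputs are restricted to powers of two,
because the binary expansion of `2 ^ k`, and with it the input tape, is a constant prefix followed
by `k` copies of a constant block, and so is visibly computable from `k`. -/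
theorem exists_boolTM_of_code (c : ToPartrec.Code) :
    ∃ (Λ : Type) (_ : Inhabited Λ) (M : TM0.Machine Bool Λ) (S : Finset Λ) (b₁ b₂ : List Bool),
      TM0.Supports M (S : Set Λ) ∧ ∀ k,
        (TM0.eval M (b₁ ++ (List.range k).flatMap fun _ => b₂)).Dom ↔ (c.eval [2 ^ k]).Dom := by
  let _ : Inhabited PartrecToTM2.Λ' := ⟨PartrecToTM2.trNormal c PartrecToTM2.Cont'.halt⟩
  let _ : Fintype PartrecToTM2.K' := ⟨{.main, .rev, .aux, .stack}, by rintro ⟨⟩ <;> simp⟩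
  obtain ⟨n, enc, dec, enc0, encdec⟩ :=
    TM1to1.exists_enc_dec (Γ := TM2to1.Γ' PartrecToTM2.K' fun _ => PartrecToTM2.Γ')
  let M₁ := TM2to1.tr PartrecToTM2.tr
  let M₂ := TM1to1.tr enc dec M₁
  have h₂ := TM1to1.tr_supports enc dec M₁
    (TM2to1.tr_supports PartrecToTM2.tr (PartrecToTM2.tr_supports c PartrecToTM2.Cont'.halt))
  -- `sym a` is the tape symbol that carries `a` on the main stack and nothing on the others.
  let sym : PartrecToTM2.Γ' → TM2to1.Γ' PartrecToTM2.K' fun _ => PartrecToTM2.Γ' :=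
    fun a => (false, Function.update (fun _ => none) PartrecToTM2.K'.main (some a))
  refine ⟨_, _, TM1to0.tr M₂, _, (enc (true, (sym .cons).2)).toList ++ (enc (sym .bit1)).toList,
    (enc (sym .bit0)).toList, TM1to0.tr_supports M₂ h₂, fun k => ?_⟩
  have hL : TM2to1.trInit PartrecToTM2.K'.main (PartrecToTM2.trList [2 ^ k]) =
      (true, (sym .cons).2) :: sym .bit1 :: List.replicate k (sym .bit0) := by
    have h : (PartrecToTM2.trList [2 ^ k]).reverse = .cons :: .bit1 :: List.replicate k .bit0 := by
      simp [trNat_two_pow]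
    rw [TM2to1.trInit, h]
    change (true, (sym .cons).2) :: sym .bit1 :: List.map sym (List.replicate k .bit0) = _
    rw [List.map_replicate]
  have hinit : ∀ L, TM1to1.trCfg (Λ := TM2to1.Λ' PartrecToTM2.K' (fun _ => PartrecToTM2.Γ')
      PartrecToTM2.Λ' (Option PartrecToTM2.Γ')) (σ := Option PartrecToTM2.Γ') enc enc0
      (TM1.init L) = TM1.init (L.flatMap fun x => (enc x).toList) := by
    intro L
    simp only [TM1.init, TM1to1.trCfg, Tape.mk₁, Tape.mk₂, TM1to1.trTape_mk', TM1to1.trTape',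
      ListBlank.flatMap_mk]
    rfl
  rw [TM1to0.tr_eval]
  have e₂ := StateTransition.tr_eval_dom (TM1to1.tr_respects dec M₁ encdec (enc0 := enc0))
    (hinit (TM2to1.trInit PartrecToTM2.K'.main (PartrecToTM2.trList [2 ^ k])))
  have e₁ := TM2to1.tr_eval_dom PartrecToTM2.tr PartrecToTM2.K'.main
    (PartrecToTM2.trList [2 ^ k])
  have e₀ := PartrecToTM2.tr_eval c [2 ^ k]
  have hi : (TM2.init PartrecToTM2.K'.main (PartrecToTM2.trList [2 ^ k]) : PartrecToTM2.Cfg') =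
      PartrecToTM2.init c [2 ^ k] := by
    simp only [TM2.init, PartrecToTM2.init]
    congr 1
    funext x
    cases x <;> rfl
  have e₀' : (TM2.eval PartrecToTM2.tr PartrecToTM2.K'.main
      (PartrecToTM2.trList [2 ^ k])).Dom ↔ (c.eval [2 ^ k]).Dom := by
    change (StateTransition.eval _ (TM2.init _ _ : PartrecToTM2.Cfg')).Dom ↔ _
    rw [hi]
    exact iff_of_eq (congrArg Part.Dom e₀)
  refine Iff.trans ?_ (e₂.trans (e₁.trans e₀'))
  rw [hL]
  have h : ∀ {α : Type} (g : α → List Bool) (x y z : α), g x ++ g y ++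
      (List.range k).flatMap (fun _ => g z) = (x :: y :: List.replicate k z).flatMap g := by
    intro α g x y z
    have : List.replicate k z = (List.range k).map fun _ => z := by simp
    rw [this, List.flatMap_cons, List.flatMap_cons, List.flatMap_map, List.append_assoc]
  exact iff_of_eq (congrArg (fun l => (TM1.eval M₂ l).Dom) (h (fun x => (enc x).toList) _ _ _))

theorem primrec_two_pow : Primrec fun k : ℕ => 2 ^ k :=
  (Primrec.nat_rec₁ 1 ((Primrec.nat_mul.comp Primrec.snd (Primrec.const 2)).to₂)).of_eq fun k => by
    induction k with
    | zero => rfl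
    | succ k ih => simp [pow_succ, ← ih]

/-- A universal code: on input `2 ^ k` it finds `k` by search and runs the `k`-th program. -/
theorem exists_code_halting : ∃ c : Turing.ToPartrec.Code, ∀ k,
    (c.eval [2 ^ k]).Dom ↔
      (Nat.Partrec.Code.eval (Denumerable.ofNat Nat.Partrec.Code k) 0).Dom := by
  let f : List.Vector ℕ 1 →. ℕ := fun v =>
    (Nat.rfind fun j => Part.some (decide (2 ^ j = v.head))).bind fun k =>
      Nat.Partrec.Code.eval (Denumerable.ofNat Nat.Partrec.Code k) 0
  have hf : Partrec f := by
    refine Partrec.bind (Partrec.rfind ?_) ?_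
    · have : PrimrecPred fun p : List.Vector ℕ 1 × ℕ => 2 ^ p.2 = p.1.head :=
        Primrec.eq.comp (primrec_two_pow.comp Primrec.snd)
          (Primrec.vector_head.comp Primrec.fst)
      exact this.decide.to_comp.partrec
    · exact Nat.Partrec.Code.eval_part.comp ((Computable.ofNat _).comp Computable.snd)
        (Computable.const 0)
  obtain ⟨c, hc⟩ := Turing.ToPartrec.Code.exists_code (Nat.Partrec'.part_iff.2 hf)
  refine ⟨c, fun k => ?_⟩
  have hk : (Nat.rfind fun j => Part.some (decide (2 ^ j = 2 ^ k))) = Part.some k := by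
    refine Part.eq_some_iff.2 (Nat.mem_rfind.2 ⟨by simp, fun {m} hm => ?_⟩)
    rw [Part.mem_some_iff, eq_comm, decide_eq_false_iff_not]
    exact fun h => hm.ne (Nat.pow_right_injective le_rfl h)
  have := hc ⟨[2 ^ k], rfl⟩
  change c.eval [2 ^ k] = _ at this
  rw [this]
  change (f ⟨[2 ^ k], rfl⟩).Dom ↔ _
  change ((Nat.rfind fun j => Part.some (decide (2 ^ j = 2 ^ k))).bind _).Dom ↔ _
  rw [hk, Part.bind_some]

/-- There is a fixed Turing machine over `Bool` with an undecidable halting problem, even for inputs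
computed by a primitive recursive function from the code of a program. -/
theorem exists_undecidable_finTM :
    ∃ (N : ℕ) (T : Turing.TM0.Machine Bool (Fin (N + 1))) (q₀ : Fin (N + 1)) (tape : ℕ → List Bool),
      Primrec tape ∧ ¬ ComputablePred fun c : Nat.Partrec.Code =>
        (StateTransition.eval (Turing.TM0.step T)
          ⟨q₀, Turing.Tape.mk₁ (tape (Encodable.encode c))⟩).Dom := by
  obtain ⟨c, hc⟩ := exists_code_halting
  obtain ⟨Λ, _, M, S, b₁, b₂, hS, hM⟩ := exists_boolTM_of_code c
  obtain ⟨N, T, q₀, hT⟩ := exists_finTM M S hS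
  refine ⟨N, T, q₀, fun k => b₁ ++ (List.range k).flatMap fun _ => b₂, ?_, ?_⟩
  · exact Primrec.list_append.comp (Primrec.const b₁)
      (Primrec.list_flatMap Primrec.list_range (Primrec.const b₂).to₂)
  · simp only [hT, hM, hc, Denumerable.ofNat_encode]
    exact ComputablePred.halting_problem 0

/-! ### The grammar of directed paths -/

namespace LGraph

variable {V A : Type} [DecidableEq V] [DecidableEq A]

theorem replaceEdge_terminal {G H : LGraph (A ⊕ V)} {e : ℕ × ℕ × (A ⊕ V)} (he : e ∈ G.edges) {a : A}
    (hH : (SPRhs.terminal a).IsGraph H) :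
    (G.replaceEdge e he H).nodes = G.nodes ∧
      (G.replaceEdge e he H).edges = (e.1, e.2.1, Sum.inl a) ::ₘ G.edges.erase e := by
  obtain ⟨hne, hn, hE⟩ := hH
  constructor
  · simp [replaceEdge, hn]
  · simp only [replaceEdge, hE, Multiset.map_singleton, fuse, if_neg hne.symm, if_true]
    rw [add_comm, Multiset.singleton_add]

theorem replaceEdge_series {G H : LGraph (A ⊕ V)} {e : ℕ × ℕ × (A ⊕ V)} (he : e ∈ G.edges)
    {v₁ v₂ : V} {w : ℕ} (hne : H.source ≠ H.sink) (hw : w ≠ H.source) (hw' : w ≠ H.sink)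
    (hn : H.nodes = {H.source, H.sink, w})
    (hE : H.edges = {(H.source, w, Sum.inr v₁), (w, H.sink, Sum.inr v₂)}) :
    (G.replaceEdge e he H).nodes = insert w G.nodes ∧
      (G.replaceEdge e he H).edges =
        (e.1, w, Sum.inr v₁) ::ₘ (w, e.2.1, Sum.inr v₂) ::ₘ G.edges.erase e := by
  constructor
  · ext x
    simp only [replaceEdge, hn, Finset.mem_union, Finset.mem_sdiff, Finset.mem_insert,
      Finset.mem_singleton]
    constructor
    · tauto
    · rintro (rfl | h)
      · tauto
      · tauto
  · simp only [replaceEdge, hE, Multiset.insert_eq_cons, Multiset.map_cons, Multiset.map_singleton,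
      fuse, if_neg hne.symm, if_true, if_neg hw, if_neg hw']
    rw [add_comm, Multiset.cons_add, Multiset.singleton_add]

end LGraph

/-- The grammar `S → S · S`, `S → a`, which derives the directed paths. -/
def pathGrammar : SPGG (Fin 1) (Fin 1) where
  rules := {(0, .series 0 0), (0, .terminal 0)}
  start := 0

/-- The displacement along a path of a traversal in the given direction. -/
def Dir.toInt : Dir → ℤ
  | .fwd => 1
  | .bwd => -1

/-- `f` is a leveling of `G`: it is injective on the nodes, every edge leads from a level to the
next one, and no two edges leave the same node. -/
structure IsLeveling {L : Type} (G : LGraph L) (f : ℕ → ℤ) : Prop where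
  injOn : Set.InjOn f G.nodes
  edge : ∀ e ∈ G.edges, f e.2.1 = f e.1 + 1
  nodup : (G.edges.map Prod.fst).Nodup

/-- A series rule inserts a node after the source `n` of the replaced edge, so that the levels above
that of `n` are shifted by one. Since no other edge leaves `n`, no edge is stretched by this. -/
theorem exists_leveling_of_step {G G' : LGraph (Fin 1 ⊕ Fin 1)} (h : pathGrammar.Step G G')
    {f : ℕ → ℤ} (hf : IsLeveling G f) : ∃ f', IsLeveling G' f' := by
  obtain ⟨n, n', v, he, rhs, H, hr, hH, hd, rfl⟩ := h
  obtain ⟨E, hE⟩ := Multiset.exists_cons_of_mem he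
  have hn := G.edges_mem _ he
  dsimp only at hn
  have hfe : f n' = f n + 1 := hf.edge _ he
  have hnd := hf.nodup
  rw [hE, Multiset.map_cons, Multiset.nodup_cons] at hnd
  rcases hr with hr | hr
  · obtain ⟨rfl, rfl⟩ := Prod.mk.inj hr
    obtain ⟨hne, w, hw, hw', hN, hHE⟩ := hH
    obtain ⟨h1, h2⟩ := LGraph.replaceEdge_series he hne hw hw' hN hHE
    have hwG : w ∉ G.nodes := fun hh =>
      Finset.disjoint_left.1 hd hh (by rw [hN]; simp)
    rw [hE, Multiset.erase_cons_head] at h2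
    have hmem : ∀ e ∈ E, e.1 ∈ G.nodes ∧ e.2.1 ∈ G.nodes := fun e h =>
      G.edges_mem e (by rw [hE]; exact Multiset.mem_cons_of_mem h)
    have hnw : n ≠ w := fun h => hwG (h ▸ hn.1)
    have hnw' : n' ≠ w := fun h => hwG (h ▸ hn.2)
    refine ⟨fun x => if x = w then f n + 1 else if f x ≤ f n then f x else f x + 1, ?_, ?_, ?_⟩
    · rw [h1]
      intro x hx y hy hxy
      simp only [Finset.coe_insert, Set.mem_insert_iff, Finset.mem_coe] at hx hy
      have hi : x ∈ G.nodes → y ∈ G.nodes → f x = f y → x = y := fun a b c => hf.injOn a b c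
      dsimp only at hxy
      split_ifs at hxy <;> first | omega | (apply hi <;> first | tauto | omega)
    · rw [h2]
      intro e hee
      rcases Multiset.mem_cons.1 hee with rfl | hee
      · simp [hnw]
      rcases Multiset.mem_cons.1 hee with rfl | hee
      · simp [hnw', hfe]
      have hm := hmem e hee
      have h3 : e.1 ≠ w := fun h => hwG (h ▸ hm.1)
      have h4 : e.2.1 ≠ w := fun h => hwG (h ▸ hm.2)
      have h5 : e.1 ≠ n := fun h => hnd.1 (Multiset.mem_map.2 ⟨e, hee, h⟩)
      have h6 : f e.1 ≠ f n := fun h => h5 (hf.injOn hm.1 hn.1 h)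
      have h7 := hf.edge e (by rw [hE]; exact Multiset.mem_cons_of_mem hee)
      simp only [if_neg h3, if_neg h4]
      split_ifs <;> omega
    · rw [h2]
      simp only [Multiset.map_cons, Multiset.nodup_cons, Multiset.mem_cons, not_or]
      refine ⟨⟨hnw, hnd.1⟩, fun h => ?_, hnd.2⟩
      obtain ⟨e, hee, h⟩ := Multiset.mem_map.1 h
      exact hwG (h ▸ (hmem e hee).1)
  · obtain ⟨rfl, rfl⟩ := Prod.mk.inj hr
    obtain ⟨h1, h2⟩ := LGraph.replaceEdge_terminal he hH
    rw [hE, Multiset.erase_cons_head] at h2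
    refine ⟨f, ?_, ?_, ?_⟩
    · rw [h1]; exact hf.injOn
    · rw [h2]
      intro e hee
      rcases Multiset.mem_cons.1 hee with rfl | hee
      · exact hfe
      · exact hf.edge e (by rw [hE]; exact Multiset.mem_cons_of_mem hee)
    · rw [h2, Multiset.map_cons, Multiset.nodup_cons]
      exact hnd

/-- Graphs of the language have no branching: the position of the machine on a graph is
determined by its level. -/
theorem exists_levels_of_mem_symmLanguage {G : LGraph (Fin 1 × Dir)}
    (hG : G ∈ pathGrammar.symmLanguage) :
    ∃ f : ℕ → ℤ, Set.InjOn f G.nodes ∧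
      ∀ n n' l, (n, n', l) ∈ G.edges → f n' = f n + l.2.toInt := by
  obtain ⟨G, hG, rfl⟩ := hG
  have key : ∀ D, Relation.ReflTransGen pathGrammar.Step pathGrammar.initialGraph D →
      ∃ f, IsLeveling D f := by
    intro D hD
    induction hD with
    | refl =>
      refine ⟨fun x => x, fun x _ y _ h => by simpa using h, ?_, ?_⟩ <;>
        simp [SPGG.initialGraph]
    | tail _ h ih =>
      obtain ⟨f, hf⟩ := ih
      exact exists_leveling_of_step h hf
  obtain ⟨f, hf⟩ := key _ hG
  have hedge : ∀ e ∈ G.edges, f e.2.1 = f e.1 + 1 := fun e he =>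
    hf.edge _ (Multiset.mem_map_of_mem (fun e => (e.1, e.2.1, Sum.inl e.2.2)) he)
  refine ⟨f, hf.injOn, fun n n' l h => ?_⟩
  rcases Multiset.mem_add.1 h with h | h
  · obtain ⟨e, he, h⟩ := Multiset.mem_map.1 h
    obtain ⟨rfl, rfl, rfl⟩ := by simpa using h
    simp [Dir.toInt, hedge e he]
  · obtain ⟨e, he, h⟩ := Multiset.mem_map.1 h
    obtain ⟨rfl, rfl, rfl⟩ := by simpa using h
    simp [Dir.toInt, hedge e he]

/-- The source and the sink of the copy of the right-hand side are fused away, so that any two fresh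
nodes serve for them; the inner node `w` can be chosen. -/
theorem exists_step_series {G : LGraph (Fin 1 ⊕ Fin 1)} {n n' w : ℕ}
    (he : (n, n', Sum.inr 0) ∈ G.edges) (hw : w ∉ G.nodes) :
    ∃ G', pathGrammar.Step G G' ∧ G'.source = G.source ∧ G'.sink = G.sink ∧
      G'.nodes = insert w G.nodes ∧
      G'.edges = (n, w, Sum.inr 0) ::ₘ (w, n', Sum.inr 0) ::ₘ G.edges.erase (n, n', Sum.inr 0) := by
  obtain ⟨x, hx⟩ := Infinite.exists_notMem_finset (insert w G.nodes)
  obtain ⟨y, hy⟩ := Infinite.exists_notMem_finset (insert x (insert w G.nodes))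
  simp only [Finset.mem_insert, not_or] at hx hy
  let H : LGraph (Fin 1 ⊕ Fin 1) :=
    { nodes := {x, y, w}
      edges := {(x, w, Sum.inr 0), (w, y, Sum.inr 0)}
      source := x
      sink := y
      source_mem := by simp
      sink_mem := by simp
      edges_mem := by simp }
  have hxy : H.source ≠ H.sink := Ne.symm hy.1
  have hwx : w ≠ H.source := Ne.symm hx.1
  have hwy : w ≠ H.sink := Ne.symm hy.2.1
  refine ⟨G.replaceEdge _ he H, ⟨n, n', 0, he, .series 0 0, H, Or.inl rfl,
    ⟨hxy, w, hwx, hwy, rfl, rfl⟩, ?_, rfl⟩, rfl, rfl,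
    LGraph.replaceEdge_series he hxy hwx hwy rfl rfl⟩
  simp only [H, Finset.disjoint_insert_right, Finset.disjoint_singleton_right]
  exact ⟨hx.2, hy.2.2, hw⟩

theorem exists_step_terminal {G : LGraph (Fin 1 ⊕ Fin 1)} {n n' : ℕ}
    (he : (n, n', Sum.inr 0) ∈ G.edges) :
    ∃ G', pathGrammar.Step G G' ∧ G'.source = G.source ∧ G'.sink = G.sink ∧
      G'.nodes = G.nodes ∧
      G'.edges = (n, n', Sum.inl 0) ::ₘ G.edges.erase (n, n', Sum.inr 0) := by
  obtain ⟨x, hx⟩ := Infinite.exists_notMem_finset G.nodes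
  obtain ⟨y, hy⟩ := Infinite.exists_notMem_finset (insert x G.nodes)
  simp only [Finset.mem_insert, not_or] at hx hy
  let H : LGraph (Fin 1 ⊕ Fin 1) :=
    { nodes := {x, y}
      edges := {(x, y, Sum.inl 0)}
      source := x
      sink := y
      source_mem := by simp
      sink_mem := by simp
      edges_mem := by simp }
  have hH : (SPRhs.terminal (0 : Fin 1) : SPRhs (Fin 1) (Fin 1)).IsGraph H :=
    ⟨Ne.symm hy.1, rfl, rfl⟩
  refine ⟨G.replaceEdge _ he H, ⟨n, n', 0, he, .terminal 0, H, Or.inr rfl, hH, ?_, rfl⟩, rfl, rfl,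
    LGraph.replaceEdge_terminal he hH⟩
  simp only [H, Finset.disjoint_insert_right, Finset.disjoint_singleton_right]
  exact ⟨hx, hy.2⟩

/-- The directed path `0 → k + 1 → k → ⋯ → 2 → 1`. -/
def pathGraph (k : ℕ) : LGraph (Fin 1) where
  nodes := Finset.range (k + 2)
  edges := (0, k + 1, 0) ::ₘ (Multiset.range k).map fun j => (j + 2, j + 1, 0)
  source := 0
  sink := 1
  source_mem := by simp
  sink_mem := by simp
  edges_mem := by
    intro e he
    rcases Multiset.mem_cons.1 he with rfl | he
    · simp
    · obtain ⟨j, hj, rfl⟩ := Multiset.mem_map.1 he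
      have := Multiset.mem_range.1 hj
      simp only [Finset.mem_range]
      omega

/-- The edge at the source is expanded again and again, and the second half of each expansion is
made terminal at once. -/
theorem exists_derivation_path (k : ℕ) :
    ∃ G, Relation.ReflTransGen pathGrammar.Step pathGrammar.initialGraph G ∧
      G.source = 0 ∧ G.sink = 1 ∧ G.nodes = Finset.range (k + 2) ∧
      G.edges = (0, k + 1, Sum.inr 0) ::ₘ
        (Multiset.range k).map fun j => (j + 2, j + 1, Sum.inl 0) := by
  induction k with
  | zero => exact ⟨_, .refl, rfl, rfl, rfl, rfl⟩
  | succ k ih =>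
    obtain ⟨G, hG, hs, ht, hn, hE⟩ := ih
    obtain ⟨G₁, hG₁, hs₁, ht₁, hn₁, hE₁⟩ := exists_step_series (G := G) (n := 0) (n' := k + 1)
      (w := k + 2) (by rw [hE]; exact Multiset.mem_cons_self _ _) (by rw [hn]; simp)
    rw [hE, Multiset.erase_cons_head, Multiset.cons_swap] at hE₁
    obtain ⟨G₂, hG₂, hs₂, ht₂, hn₂, hE₂⟩ := exists_step_terminal (G := G₁) (n := k + 2)
      (n' := k + 1) (by rw [hE₁]; exact Multiset.mem_cons_self _ _)
    rw [hE₁, Multiset.erase_cons_head, Multiset.cons_swap] at hE₂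
    refine ⟨G₂, (hG.tail hG₁).tail hG₂, by rw [hs₂, hs₁, hs], by rw [ht₂, ht₁, ht], ?_, ?_⟩
    · rw [hn₂, hn₁, hn, Finset.range_add_one (n := k + 2)]
    · rw [hE₂, Multiset.range_succ, Multiset.map_cons]

theorem pathGraph_mem_language (k : ℕ) : pathGraph k ∈ pathGrammar.language := by
  obtain ⟨G, hG, hs, ht, hn, hE⟩ := exists_derivation_path k
  obtain ⟨G₁, hG₁, hs₁, ht₁, hn₁, hE₁⟩ := exists_step_terminal (G := G) (n := 0) (n' := k + 1)
    (by rw [hE]; exact Multiset.mem_cons_self _ _)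
  rw [hE, Multiset.erase_cons_head] at hE₁
  have h : (pathGraph k).mapLabels Sum.inl = G₁ := by
    let D := (pathGraph k).mapLabels (Sum.inl : Fin 1 → Fin 1 ⊕ Fin 1)
    have hE' : D.edges = G₁.edges := by rw [hE₁]; simp [D, LGraph.mapLabels, pathGraph]
    have hs' : D.source = G₁.source := by rw [hs₁, hs]; rfl
    have ht' : D.sink = G₁.sink := by rw [ht₁, ht]; rfl
    have hn' : D.nodes = G₁.nodes := by rw [hn₁, hn]; rfl
    change D = G₁
    clear_value D
    cases D; cases G₁
    dsimp only at hE' hs' ht' hn'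
    subst hE' hs' ht' hn'
    rfl
  change Relation.ReflTransGen _ _ _
  rw [h]
  exact hG.tail hG₁

/-- Paths of every length occur in the language; `pos i` is the node at distance `i` from the
source. -/
theorem exists_path_mem_symmLanguage (k : ℕ) :
    ∃ G ∈ pathGrammar.symmLanguage, ∃ pos : ℕ → ℕ, pos 0 = G.source ∧
      (∀ i ≤ k + 1, pos i ∈ G.nodes) ∧ Set.InjOn pos (Set.Iic (k + 1)) ∧
      ∀ i ≤ k, (pos i, pos (i + 1), ((0 : Fin 1), Dir.fwd)) ∈ G.edges ∧
        (pos (i + 1), pos i, ((0 : Fin 1), Dir.bwd)) ∈ G.edges := by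
  refine ⟨_, ⟨_, pathGraph_mem_language k, rfl⟩, fun i => if i = 0 then 0 else k + 2 - i, rfl,
    ?_, ?_, ?_⟩
  · intro i hi
    simp only [LGraph.symmClosure, pathGraph, Finset.mem_range]
    split_ifs <;> omega
  · intro i hi j hj h
    simp only [Set.mem_Iic] at hi hj
    dsimp only at h
    split_ifs at h <;> omega
  · intro i hi
    have hE : (pathGraph k).edges =
        (0, k + 1, 0) ::ₘ (Multiset.range k).map fun j => (j + 2, j + 1, 0) := rfl
    have key : ((if i = 0 then 0 else k + 2 - i), (if i + 1 = 0 then 0 else k + 2 - (i + 1)),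
        (0 : Fin 1)) ∈ (pathGraph k).edges := by
      rcases Nat.eq_zero_or_pos i with rfl | hi0
      · simp [pathGraph]
      · rw [if_neg hi0.ne', if_neg i.succ_ne_zero]
        rw [hE]
        refine Multiset.mem_cons_of_mem (Multiset.mem_map.2 ⟨k - i, ?_, ?_⟩)
        · rw [Multiset.mem_range]; omega
        · simp only [Prod.mk.injEq, and_true]
          omega
    exact ⟨Multiset.mem_add.2 (Or.inl (Multiset.mem_map_of_mem
        (fun e => (e.1, e.2.1, (e.2.2, Dir.fwd))) key)),
      Multiset.mem_add.2 (Or.inr (Multiset.mem_map_of_mem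
        (fun e => (e.2.1, e.1, (e.2.2, Dir.bwd))) key))⟩

/-! ### Configurations of a single machine -/

namespace Config

variable {Q A : Type} {G : LGraph (A × Dir)}

/-- The configuration of one machine in state `q` at node `n`. -/
def single (n : G.nodes) (q : Q) (β : G.nodes → Bool) : Config G 1 Q where
  μ x := {p | x = n ∧ p.2 = q}
  β := β
  existsUnique_state _ := ⟨(n, q), ⟨rfl, rfl⟩, fun _ h => Prod.ext h.1 h.2⟩

theorem eq_single {γ : Config G 1 Q} {n : G.nodes} {q : Q} (h : (0, q) ∈ γ.μ n) :
    γ = single n q γ.β := by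
  obtain ⟨p, -, hp⟩ := γ.existsUnique_state 0
  have hnq := hp (n, q) h
  ext x y
  · obtain ⟨i, q'⟩ := y
    obtain rfl : i = 0 := Subsingleton.elim _ _
    constructor
    · intro hy
      have := (hp (x, q') hy).trans hnq.symm
      exact ⟨congrArg Prod.fst this, congrArg Prod.snd this⟩
    · rintro ⟨rfl, rfl⟩
      exact h
  · rfl

theorem exists_eq_single (γ : Config G 1 Q) : ∃ n q, γ = single n q γ.β := by
  obtain ⟨p, hp, -⟩ := γ.existsUnique_state 0
  exact ⟨p.1, p.2, eq_single hp⟩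

theorem isInitial_single (M : FSM Q A) :
    IsInitial M (single ⟨G.source, G.source_mem⟩ M.init fun _ => false) := by
  refine ⟨?_, fun n hn => ?_, fun _ => rfl⟩
  · ext p; simp [single]
  · ext p
    simp only [single, Set.mem_ofPred_eq, Set.mem_empty_iff_false, iff_false]
    rintro ⟨rfl, -⟩
    exact hn rfl

theorem IsInitial.eq_single {M : FSM Q A} {γ : Config G 1 Q} (h : IsInitial M γ) :
    γ = single ⟨G.source, G.source_mem⟩ M.init fun _ => false := by
  have hβ : γ.β = fun _ => false := funext h.2.2
  rw [← hβ]
  exact Config.eq_single (by rw [h.1]; rfl)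

open Classical in
theorem step_single {M : FSM Q A} {n n' : G.nodes} {l : A × Dir} {q q' : Q} {b' : Bool}
    {β : G.nodes → Bool} (he : ((n : ℕ), (n' : ℕ), l) ∈ G.edges) (hne : n' ≠ n)
    (ht : (q, l, β n, q', b') ∈ M.trans) :
    Step M (single n q β) (single n' q' (Function.update β n b')) := by
  refine ⟨0, n, n', l, q, q', b', he, ⟨rfl, rfl⟩, ht, ?_, ?_, ?_, by simp [single],
    fun n'' h => by simp [single, h]⟩
  · ext ⟨i, p⟩
    obtain rfl : i = 0 := Subsingleton.elim _ _
    simp [single, hne.symm]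
  · ext ⟨i, p⟩
    obtain rfl : i = 0 := Subsingleton.elim _ _
    simp [single, hne]
  · intro n'' h1 h2
    ext p
    simp [single, h1, h2]

open Classical in
theorem Step.exists_of_single {M : FSM Q A} {n : G.nodes} {q : Q} {β : G.nodes → Bool}
    {γ' : Config G 1 Q} (h : Step M (single n q β) γ') :
    ∃ (n' : G.nodes) (l : A × Dir) (q' : Q) (b' : Bool), ((n : ℕ), (n' : ℕ), l) ∈ G.edges ∧
      (q, l, β n, q', b') ∈ M.trans ∧ γ' = single n' q' (Function.update β n b') := by
  obtain ⟨i, m, n', l, p, q', b', he, ⟨rfl, rfl⟩, ht, -, hμ, -, hb, hβ⟩ := h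
  refine ⟨n', l, q', b', he, ht, ?_⟩
  have h1 : γ' = single n' q' γ'.β := by
    apply Config.eq_single
    rw [hμ]
    exact Or.inr (by rw [Subsingleton.elim i 0]; rfl)
  have h2 : γ'.β = Function.update β m b' := by
    funext x
    by_cases hx : x = m
    · subst hx; simpa using hb
    · rw [Function.update_of_ne hx]; exact hβ x hx
  rw [h1, h2]

/-- The invariant method for runs. -/
theorem IsRun.forall_mem {M : FSM Q A} {m : ℕ} {ρ : List (Config G m Q)} (hρ : IsRun M ρ)
    {P : Config G m Q → Prop} (h0 : ∀ γ, IsInitial M γ → P γ)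
    (hs : ∀ γ γ', P γ → Step M γ γ' → P γ') : ∀ γ ∈ ρ, P γ := by
  obtain ⟨⟨γ₀, hγ₀, hi⟩, hc⟩ := hρ
  cases ρ with
  | nil => simp
  | cons a ρ =>
    obtain rfl : a = γ₀ := by simpa using hγ₀
    have h := h0 _ hi
    clear hγ₀ hi
    induction ρ generalizing a with
    | nil => simpa using h
    | cons b ρ ih =>
      rw [List.isChain_cons_cons] at hc
      intro γ hγ
      rcases List.mem_cons.1 hγ with rfl | hγ
      · exact h
      · exact ih b hc.2 (hs _ _ h hc.1) γ hγ

theorem exists_isRun {M : FSM Q A} {m : ℕ} {γ₀ γ : Config G m Q} (h0 : IsInitial M γ₀)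
    (h : Relation.ReflTransGen (Step M) γ₀ γ) : ∃ ρ, IsRun M ρ ∧ γ ∈ ρ := by
  obtain ⟨l, hl, hlast⟩ := List.exists_isChain_cons_of_relationReflTransGen h
  exact ⟨γ₀ :: l, ⟨⟨γ₀, rfl, h0⟩, hl⟩, hlast ▸ List.getLast_mem _⟩

theorem sat_atom_single_iff {n : G.nodes} {q p : Q} {β : G.nodes → Bool} [DecidableEq Q] :
    (ConfigProperty.atom fun x => if x = p then 1 else 0).Sat (single n q β) ↔ q = p := by
  constructor
  · rintro ⟨n', h⟩
    have h : (if p = p then 1 else 0) ≤ _ := h p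
    rw [if_pos rfl, Nat.succ_le_iff, Set.ncard_pos] at h
    obtain ⟨i, hi⟩ := h
    exact hi.2.symm
  · rintro rfl
    refine ⟨n, fun x => ?_⟩
    dsimp only
    split_ifs with hx
    · exact Nat.succ_le_iff.2 ((Set.ncard_pos).2 ⟨0, rfl, hx⟩)
    · exact Nat.zero_le _

end Config

/-! ### The simulating machine and its soundness -/

/-- The states of the machine that simulates a Turing machine with states `Fin (N + 1)`. In state
`run q` the simulated machine is in state `q` and scans the current node; in `back q` it is in
state `q` and scans the node on the left. `seek` is the initial state, in which the machine walks
away from the source; in `load j` the first `j` cells of the input have yet to be written, the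
last of them at the current node (`load 0` is entered one node to the left of the first cell). -/
inductive SimState (N : ℕ) where
  | run (q : Fin (N + 1))
  | back (q : Fin (N + 1))
  | halt
  | seek
  | load (j : ℕ)

namespace SimState

variable {N : ℕ}

/-- The number of a state. -/
def code : SimState N → ℕ
  | run q => q
  | back q => N + 1 + q
  | halt => 2 * N + 2
  | seek => 2 * N + 3
  | load j => 2 * N + 4 + j

theorem code_injective : Function.Injective (code (N := N)) := by
  intro c c' h
  cases c <;> cases c' <;> simp only [code] at h <;> first | omega | (congr <;> omega)

end SimState


section

open Turing (TM0.Machine TM0.Stmt TM0.step Tape)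

variable {N : ℕ}

/-- The transitions that do not depend on the input: in state `c`, on register value `b`, move in
direction `d` to state `c'` and write `b'`. As every transition of the machine moves, the
instruction to write at the head is executed by moving right and back. -/
inductive CoreTrans (T : TM0.Machine Bool (Fin (N + 1))) (q₀ : Fin (N + 1)) :
    SimState N → Dir → Bool → SimState N → Bool → Prop
  | right {q b q'} (h : T q b = some (q', .move .right)) :
      CoreTrans T q₀ (.run q) .fwd b (.run q') b
  | left {q b q'} (h : T q b = some (q', .move .left)) :
      CoreTrans T q₀ (.run q) .bwd b (.run q') b
  | write {q b q' a} (h : T q b = some (q', .write a)) :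
      CoreTrans T q₀ (.run q) .fwd b (.back q') a
  | halt {q b} (h : T q b = none) : CoreTrans T q₀ (.run q) .fwd b .halt b
  | back (q b) : CoreTrans T q₀ (.back q) .bwd b (.run q) b
  | seek : CoreTrans T q₀ .seek .fwd false .seek false
  | start : CoreTrans T q₀ (.load 0) .fwd false (.run q₀) false

/-- All transitions of the machine that writes the input `l` and then simulates `T`. -/
inductive SimTrans (T : TM0.Machine Bool (Fin (N + 1))) (q₀ : Fin (N + 1)) (l : List Bool) :
    SimState N → Dir → Bool → SimState N → Bool → Prop
  | core {c d b c' b'} (h : CoreTrans T q₀ c d b c' b') : SimTrans T q₀ l c d b c' b'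
  | enter : SimTrans T q₀ l .seek .fwd false (.load l.length) false
  | load (j : ℕ) (h : j < l.length) :
      SimTrans T q₀ l (.load (j + 1)) .bwd false (.load j) (l.getD j false)

theorem CoreTrans.code_lt {T : TM0.Machine Bool (Fin (N + 1))} {q₀ : Fin (N + 1)}
    {c c' : SimState N} {d : Dir} {b b' : Bool} (h : CoreTrans T q₀ c d b c' b') :
    c.code < 2 * N + 5 ∧ c'.code < 2 * N + 5 := by
  cases h <;> simp only [SimState.code] <;> omega

theorem SimTrans.code_lt {T : TM0.Machine Bool (Fin (N + 1))} {q₀ : Fin (N + 1)} {l : List Bool}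
    {c c' : SimState N} {d : Dir} {b b' : Bool} (h : SimTrans T q₀ l c d b c' b') :
    c.code < 2 * N + 5 + l.length ∧ c'.code < 2 * N + 5 + l.length := by
  cases h with
  | core h => have := h.code_lt; omega
  | enter => simp only [SimState.code]; omega
  | load j h => simp only [SimState.code]; omega

/-- The machine that walks away from the source, writes the input `l` to the registers and then
simulates `T`. -/
def simMachine (T : TM0.Machine Bool (Fin (N + 1))) (q₀ : Fin (N + 1)) (l : List Bool) :
    FSM (Fin (2 * N + 5 + l.length)) (Fin 1) where
  init := ⟨2 * N + 3, by omega⟩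
  trans := {t | ∃ c c', SimTrans T q₀ l c t.2.1.2 t.2.2.1 c' t.2.2.2.2 ∧ c.code = t.1 ∧
    c'.code = t.2.2.2.1}

/-- The property that the machine is in its halting state. -/
def haltProperty (N k : ℕ) : ConfigProperty (Fin (2 * N + 5 + k)) :=
  .atom fun x => if x = ⟨2 * N + 2, by omega⟩ then 1 else 0

theorem nth_mk₁_of_nonneg (l : List Bool) (i : ℕ) : (Tape.mk₁ l).nth i = l.getD i false := by
  rw [Tape.mk₁, Turing.Tape.mk₂, Turing.Tape.mk'_nth_nat, Turing.ListBlank.nth_mk,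
    List.getI_eq_getElem?_getD, List.getD_eq_getElem?_getD]
  rfl

theorem nth_mk₁_of_neg (l : List Bool) {i : ℤ} (hi : i < 0) : (Tape.mk₁ l).nth i = false := by
  obtain ⟨n, rfl⟩ := Int.exists_eq_neg_ofNat hi.le
  cases n with
  | zero => simp at hi
  | succ n =>
    change (Turing.ListBlank.mk ([] : List Bool)).nth n = false
    rw [Turing.ListBlank.nth_mk]
    cases n <;> rfl

theorem nth_mk₁_of_length_le (l : List Bool) {i : ℤ} (hi : l.length ≤ i) :
    (Tape.mk₁ l).nth i = false := by
  obtain ⟨n, rfl⟩ := Int.eq_ofNat_of_zero_le (by omega : 0 ≤ i)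
  rw [nth_mk₁_of_nonneg, List.getD_eq_default _ _ (by exact_mod_cast hi)]

section Soundness

variable {G : LGraph (Fin 1 × Dir)}

/-- What a reachable configuration of the simulating machine, with levels `f` of the nodes, says
about the Turing machine. The registers show the tape, relative to the current node. -/
def SimInv (T : TM0.Machine Bool (Fin (N + 1))) (q₀ : Fin (N + 1)) (l : List Bool) (f : ℕ → ℤ)
    (n : G.nodes) (β : G.nodes → Bool) : SimState N → Prop
  | .run q => ∃ t, StateTransition.Reaches (TM0.step T) ⟨q₀, Tape.mk₁ l⟩ ⟨q, t⟩ ∧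
      ∀ x : G.nodes, β x = t.nth (f x - f n)
  | .back q => ∃ t, StateTransition.Reaches (TM0.step T) ⟨q₀, Tape.mk₁ l⟩ ⟨q, t⟩ ∧
      ∀ x : G.nodes, β x = t.nth (f x - f n + 1)
  | .halt => (StateTransition.eval (TM0.step T) ⟨q₀, Tape.mk₁ l⟩).Dom
  | .seek => ∀ x, β x = false
  | .load j => ∀ x : G.nodes, β x =
      if j ≤ f x - f n + j - 1 then (Tape.mk₁ l).nth (f x - f n + j - 1) else false

open Classical in
/-- Every step of the machine corresponds to at most one step of the Turing machine. -/
theorem SimInv.step {T : TM0.Machine Bool (Fin (N + 1))} {q₀ : Fin (N + 1)} {l : List Bool}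
    {f : ℕ → ℤ} (hf : Set.InjOn f G.nodes) {n n' : G.nodes} {β : G.nodes → Bool}
    {c c' : SimState N} {d : Dir} {b' : Bool} (h : SimInv T q₀ l f n β c)
    (hn : f n' = f n + d.toInt) (ht : SimTrans T q₀ l c d (β n) c' b') :
    SimInv T q₀ l f n' (Function.update β n b') c' := by
  -- By injectivity of the levels, writing at `n` changes one cell only.
  have hup : ∀ x : G.nodes, x ≠ n → f x - f n ≠ 0 := fun x hx h0 =>
    hx (Subtype.ext (hf x.2 n.2 (by omega)))
  have hhead : ∀ t : Tape Bool, (∀ x : G.nodes, β x = t.nth (f x - f n)) → t.head = β n := by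
    intro t ht
    rw [ht n, sub_self, Turing.Tape.nth_zero]
  generalize hb : β n = b at ht
  cases ht with
  | core ht =>
    cases ht with
    | right hT =>
      obtain ⟨t, hr, hβ⟩ := h
      refine ⟨t.move .right, hr.tail ?_, fun x => ?_⟩
      · simp [TM0.step, hhead t hβ, hb, hT]
      · rw [← hb, Function.update_eq_self, Turing.Tape.move_right_nth, hβ x, hn]
        congr 1; simp only [Dir.toInt]; ring
    | left hT =>
      obtain ⟨t, hr, hβ⟩ := h
      refine ⟨t.move .left, hr.tail ?_, fun x => ?_⟩
      · simp [TM0.step, hhead t hβ, hb, hT]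
      · rw [← hb, Function.update_eq_self, Turing.Tape.move_left_nth, hβ x, hn]
        congr 1; simp only [Dir.toInt]; ring
    | write hT =>
      obtain ⟨t, hr, hβ⟩ := h
      refine ⟨t.write b', hr.tail ?_, fun x => ?_⟩
      · simp [TM0.step, hhead t hβ, hb, hT]
      · have e : f x - f n' + 1 = f x - f n := by rw [hn]; simp only [Dir.toInt]; ring
        rw [e, Turing.Tape.write_nth]
        by_cases hx : x = n
        · subst hx; simp
        · rw [Function.update_of_ne hx, if_neg (hup x hx), hβ x]
    | halt hT =>
      obtain ⟨t, hr, hβ⟩ := h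
      exact Part.dom_iff_mem.2
        ⟨_, StateTransition.mem_eval.2 ⟨hr, by simp [TM0.step, hhead t hβ, hb, hT]⟩⟩
    | back q =>
      obtain ⟨t, hr, hβ⟩ := h
      refine ⟨t, hr, fun x => ?_⟩
      rw [← hb, Function.update_eq_self, hβ x, hn]
      congr 1; simp only [Dir.toInt]; ring
    | seek =>
      rw [← hb, Function.update_eq_self]
      exact h
    | start =>
      refine ⟨Tape.mk₁ l, .refl, fun x => ?_⟩
      have e : f x - f n' = f x - f n + (0 : ℕ) - 1 := by
        rw [hn]; simp only [Dir.toInt]; push_cast; ring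
      rw [← hb, Function.update_eq_self, h x, e]
      split_ifs with h0
      · rfl
      · rw [nth_mk₁_of_neg]
        omega
  | enter =>
    intro x
    rw [← hb, Function.update_eq_self, h x]
    split_ifs with h0
    · rw [nth_mk₁_of_length_le]
      omega
    · exact hb.symm
  | load j hj =>
    intro x
    have e : f x - f n' + j - 1 = f x - f n + j := by rw [hn]; simp only [Dir.toInt]; ring
    rw [e]
    by_cases hx : x = n
    · subst hx
      rw [Function.update_self, if_pos (by omega), sub_self, zero_add, nth_mk₁_of_nonneg]
    · rw [Function.update_of_ne hx, h x]
      have := hup x hx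
      have e' : f x - f n + (j + 1 : ℕ) - 1 = f x - f n + j := by push_cast; ring
      rw [e']
      by_cases h1 : (j : ℤ) ≤ f x - f n + j
      · rw [if_pos h1, if_pos (by push_cast; omega)]
      · rw [if_neg h1, if_neg (by push_cast; omega)]

end Soundness

theorem dom_of_reach {T : TM0.Machine Bool (Fin (N + 1))} {q₀ : Fin (N + 1)} {l : List Bool}
    (h : Reach (simMachine T q₀ l) 1 pathGrammar (haltProperty N l.length)) :
    (StateTransition.eval (TM0.step T) ⟨q₀, Tape.mk₁ l⟩).Dom := by
  classical
  obtain ⟨G, hG, ρ, hρ, γ, hγ, hsat⟩ := h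
  obtain ⟨f, hf, hedge⟩ := exists_levels_of_mem_symmLanguage hG
  have key := hρ.forall_mem (P := fun γ => ∃ n q β c, γ = Config.single n q β ∧
    SimState.code c = q ∧ SimInv T q₀ l f n β c) ?_ ?_ γ hγ
  · obtain ⟨n, q, β, c, rfl, hc, hinv⟩ := key
    obtain rfl := Config.sat_atom_single_iff.1 hsat
    obtain rfl : c = .halt := SimState.code_injective hc
    exact hinv
  · intro γ hi
    exact ⟨_, _, _, .seek, hi.eq_single, rfl, fun _ => rfl⟩
  · rintro _ γ' ⟨n, q, β, c, rfl, hc, hinv⟩ hs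
    obtain ⟨n', a, q', b', he, ⟨c₁, c', ht, hc₁, hc'⟩, rfl⟩ := hs.exists_of_single
    obtain rfl : c₁ = c := SimState.code_injective (hc₁.trans hc.symm)
    exact ⟨_, _, _, c', rfl, hc', hinv.step hf (hedge _ _ _ he) ht⟩

/-! ### Completeness of the simulation -/

section Completeness

variable {G : LGraph (Fin 1 × Dir)}

/-- From the configuration with the machine in state `c` at node `n` and registers `β`, the halting
state can be reached. -/
def CanHalt (T : TM0.Machine Bool (Fin (N + 1))) (q₀ : Fin (N + 1)) (l : List Bool)
    (n : G.nodes) (c : SimState N) (β : G.nodes → Bool) : Prop :=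
  ∃ (s : Fin (2 * N + 5 + l.length)) (γ : Config G 1 (Fin (2 * N + 5 + l.length))),
    c.code = s ∧ Relation.ReflTransGen (Config.Step (simMachine T q₀ l)) (Config.single n s β) γ ∧
      (haltProperty N l.length).Sat γ

theorem canHalt_halt (T : TM0.Machine Bool (Fin (N + 1))) (q₀ : Fin (N + 1)) (l : List Bool)
    (n : G.nodes) (β : G.nodes → Bool) : CanHalt T q₀ l n .halt β :=
  ⟨⟨2 * N + 2, by omega⟩, _, rfl, .refl, Config.sat_atom_single_iff.2 rfl⟩

open Classical in
theorem CanHalt.of_step {T : TM0.Machine Bool (Fin (N + 1))} {q₀ : Fin (N + 1)} {l : List Bool}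
    {n n' : G.nodes} {c c' : SimState N} {d : Dir} {β : G.nodes → Bool} {b' : Bool}
    (he : ((n : ℕ), (n' : ℕ), ((0 : Fin 1), d)) ∈ G.edges) (hne : n' ≠ n)
    (ht : SimTrans T q₀ l c d (β n) c' b')
    (h : CanHalt T q₀ l n' c' (Function.update β n b')) : CanHalt T q₀ l n c β := by
  obtain ⟨s, γ, hs, hγ, hsat⟩ := h
  exact ⟨⟨c.code, ht.code_lt.1⟩, γ, rfl,
    hγ.head (Config.step_single he hne ⟨c, c', ht, rfl, hs⟩), hsat⟩

/-- Nodes `pos 0, …, pos (k + 1)` of a graph that form a path traversable in both directions. -/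
structure IsPathMap (G : LGraph (Fin 1 × Dir)) (k : ℕ) (pos : ℕ → G.nodes) : Prop where
  injOn : Set.InjOn pos (Set.Iic (k + 1))
  fwd : ∀ i ≤ k, ((pos i : ℕ), (pos (i + 1) : ℕ), ((0 : Fin 1), Dir.fwd)) ∈ G.edges
  bwd : ∀ i ≤ k, ((pos (i + 1) : ℕ), (pos i : ℕ), ((0 : Fin 1), Dir.bwd)) ∈ G.edges

variable {T : TM0.Machine Bool (Fin (N + 1))} {q₀ : Fin (N + 1)} {l : List Bool} {k : ℕ}
  {pos : ℕ → G.nodes}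

theorem IsPathMap.ne (hp : IsPathMap G k pos) {i j : ℕ} (hi : i ≤ k + 1) (hj : j ≤ k + 1)
    (h : i ≠ j) : pos i ≠ pos j := fun h' => h (hp.injOn hi hj h')

/-- The simulation of a halting computation succeeds on all paths with enough room (`r` cells) on
both sides of the head. -/
theorem canHalt_run {c c' : Turing.TM0.Cfg Bool (Fin (N + 1))}
    (h : StateTransition.Reaches (TM0.step T) c c') (h' : TM0.step T c' = none) :
    ∃ r, 1 ≤ r ∧ ∀ (G : LGraph (Fin 1 × Dir)) (k : ℕ) (pos : ℕ → G.nodes), IsPathMap G k pos →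
      ∀ (p : ℕ) (β : G.nodes → Bool), r ≤ p → p + r ≤ k →
        (∀ i ≤ k + 1, β (pos i) = c.Tape.nth ((i : ℤ) - p)) →
        CanHalt T q₀ l (pos p) (.run c.q) β := by
  classical
  have hhead : ∀ (c : Turing.TM0.Cfg Bool (Fin (N + 1))) (G : LGraph (Fin 1 × Dir)) (k p : ℕ)
      (pos : ℕ → G.nodes) (β : G.nodes → Bool), p ≤ k →
      (∀ i ≤ k + 1, β (pos i) = c.Tape.nth ((i : ℤ) - p)) → β (pos p) = c.Tape.head := by
    intro c G k p pos β hpk hβ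
    rw [hβ p (by omega), sub_self, Turing.Tape.nth_zero]
  induction h using Relation.ReflTransGen.head_induction_on with
  | refl =>
    refine ⟨1, le_rfl, fun G k pos hp p β h1 h2 hβ => ?_⟩
    have hb := hhead _ G k p pos β (by omega) hβ
    have hT : T c'.q (β (pos p)) = none := by
      rw [hb]
      simpa [TM0.step] using h'
    exact CanHalt.of_step (hp.fwd p (by omega)) (hp.ne (by omega) (by omega) (by omega))
      (.core (.halt hT)) (canHalt_halt _ _ _ _ _)
  | @head c c₁ hc _ ih =>
    obtain ⟨r, hr, ih⟩ := ih
    refine ⟨r + 1, by omega, fun G k pos hp p β h1 h2 hβ => ?_⟩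
    have hb := hhead _ G k p pos β (by omega) hβ
    obtain ⟨q, t⟩ := c
    obtain ⟨⟨q', s⟩, hT, rfl⟩ := Option.map_eq_some_iff.1 hc
    dsimp only at hT hβ ih hb
    rw [← hb] at hT
    rcases s with (_ | _) | a
    · obtain ⟨p, rfl⟩ : ∃ p', p = p' + 1 := ⟨p - 1, by omega⟩
      refine CanHalt.of_step (hp.bwd p (by omega)) (hp.ne (by omega) (by omega) (by omega))
        (.core (.left hT)) ?_
      rw [Function.update_eq_self]
      refine ih G k pos hp p β (by omega) (by omega) fun i hi => ?_
      rw [hβ i hi, Turing.Tape.move_left_nth]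
      congr 1; push_cast; ring
    · refine CanHalt.of_step (hp.fwd p (by omega)) (hp.ne (by omega) (by omega) (by omega))
        (.core (.right hT)) ?_
      rw [Function.update_eq_self]
      refine ih G k pos hp (p + 1) β (by omega) (by omega) fun i hi => ?_
      rw [hβ i hi, Turing.Tape.move_right_nth]
      congr 1; push_cast; ring
    · refine CanHalt.of_step (hp.fwd p (by omega)) (hp.ne (by omega) (by omega) (by omega))
        (.core (.write hT)) ?_
      refine CanHalt.of_step (hp.bwd p (by omega)) (hp.ne (by omega) (by omega) (by omega))
        (.core (.back _ _)) ?_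
      rw [Function.update_eq_self]
      refine ih G k pos hp p _ (by omega) (by omega) fun i hi => ?_
      rw [Turing.Tape.write_nth]
      by_cases hip : i = p
      · subst hip; simp
      · rw [Function.update_of_ne (hp.ne hi (by omega) hip), if_neg (by omega), hβ i hi]

/-- The loading phase succeeds if the simulation does (`hrun`). Cell `0` of the tape is the node
`pos (p + 1)`, and the cells from `j` on have already been written. -/
theorem canHalt_load (hp : IsPathMap G k pos) {p : ℕ} (hk : p + l.length ≤ k)
    (hrun : ∀ β : G.nodes → Bool, (∀ i ≤ k + 1, β (pos i) = (Tape.mk₁ l).nth ((i : ℤ) - (p + 1))) →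
      CanHalt T q₀ l (pos (p + 1)) (.run q₀) β)
    (j : ℕ) (hj : j ≤ l.length) (β : G.nodes → Bool)
    (hβ : ∀ i ≤ k + 1, β (pos i) =
      if p + 1 + j ≤ i then (Tape.mk₁ l).nth ((i : ℤ) - (p + 1)) else false) :
    CanHalt T q₀ l (pos (p + j)) (.load j) β := by
  classical
  induction j generalizing β with
  | zero =>
    rw [Nat.add_zero]
    have hb : β (pos p) = false := by rw [hβ p (by omega), if_neg (by omega)]
    refine CanHalt.of_step (hp.fwd p (by omega)) (hp.ne (by omega) (by omega) (by omega))
      (c' := .run q₀) (b' := β (pos p)) ?_ ?_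
    · rw [hb]; exact .core .start
    · rw [Function.update_eq_self]
      refine hrun _ fun i hi => ?_
      rw [hβ i hi]
      split_ifs with h
      · rfl
      · rw [nth_mk₁_of_neg]; omega
  | succ j ih =>
    have hb : β (pos (p + j + 1)) = false := by rw [hβ _ (by omega), if_neg (by omega)]
    refine CanHalt.of_step (n := pos (p + j + 1)) (hp.bwd (p + j) (by omega))
      (hp.ne (by omega) (by omega) (by omega)) (c' := .load j)
      (b' := l.getD j false) ?_ ?_
    · rw [hb]; exact .load j hj
    · refine ih (by omega) _ fun i hi => ?_
      by_cases hij : i = p + j + 1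
      · subst hij
        have e : ((p + j + 1 : ℕ) : ℤ) - (p + 1) = j := by push_cast; ring
        rw [Function.update_self, if_pos (by omega), e, nth_mk₁_of_nonneg]
      · rw [Function.update_of_ne (hp.ne hi (by omega) hij), hβ i hi]
        by_cases h : p + 1 + j ≤ i
        · rw [if_pos h, if_pos (by omega)]
        · rw [if_neg h, if_neg (by omega)]

theorem canHalt_seek (hp : IsPathMap G k pos) {p : ℕ} (hk : p ≤ k)
    (hload : CanHalt T q₀ l (pos (p + 1)) (.load l.length) fun _ => false) (i : ℕ) (hi : i ≤ p) :
    CanHalt T q₀ l (pos i) .seek fun _ => false := by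
  classical
  have h0 : ∀ n : G.nodes, Function.update (fun _ : G.nodes => false) n false = fun _ => false :=
    fun n => Function.update_eq_self n (fun _ : G.nodes => false)
  induction hi using Nat.decreasingInduction with
  | self =>
    refine CanHalt.of_step (hp.fwd p hk) (hp.ne (by omega) (by omega) (by omega)) .enter ?_
    rwa [h0]
  | of_succ i hi ih =>
    refine CanHalt.of_step (hp.fwd i (by omega)) (hp.ne (by omega) (by omega) (by omega))
      (.core .seek) ?_
    rwa [h0]

end Completeness

theorem reach_of_dom {T : TM0.Machine Bool (Fin (N + 1))} {q₀ : Fin (N + 1)} {l : List Bool}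
    (h : (StateTransition.eval (TM0.step T) ⟨q₀, Tape.mk₁ l⟩).Dom) :
    Reach (simMachine T q₀ l) 1 pathGrammar (haltProperty N l.length) := by
  obtain ⟨c, hc⟩ := Part.dom_iff_mem.1 h
  obtain ⟨hc, hc'⟩ := StateTransition.mem_eval.1 hc
  obtain ⟨r, hr, hrun⟩ := canHalt_run (q₀ := q₀) (l := l) hc hc'
  obtain ⟨G, hG, pos, h0, hn, hinj, hedge⟩ := exists_path_mem_symmLanguage (2 * r + l.length + 1)
  -- The map `pos` is used below `2 * r + l.length + 2` only; beyond it is truncated.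
  let pos' : ℕ → G.nodes := fun i => if hi : i ≤ 2 * r + l.length + 1 + 1
    then ⟨pos i, hn i hi⟩ else ⟨G.source, G.source_mem⟩
  have hpos : ∀ i ≤ 2 * r + l.length + 1 + 1, (pos' i : ℕ) = pos i := fun i hi => by
    simp only [pos', dif_pos hi]
  have hp : IsPathMap G (2 * r + l.length + 1) pos' := by
    refine ⟨fun i hi j hj h => hinj hi hj ?_, fun i hi => ?_, fun i hi => ?_⟩
    · rw [← hpos i hi, ← hpos j hj, h]
    · rw [hpos i (by omega), hpos (i + 1) (by omega)]; exact (hedge i hi).1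
    · rw [hpos i (by omega), hpos (i + 1) (by omega)]; exact (hedge i hi).2
  have hload := canHalt_load (T := T) (q₀ := q₀) hp (p := r) (by omega)
    (fun β hβ => hrun G _ pos' hp (r + 1) β (by omega) (by omega) (by exact_mod_cast hβ))
    l.length le_rfl (fun _ => false) fun i hi => by
      split_ifs with hi'
      · rw [nth_mk₁_of_length_le]; omega
      · rfl
  -- The walk ends at distance `r + l.length`, so that the head starts at distance `r + 1`.
  obtain ⟨p, hpr⟩ : ∃ p, r + l.length = p + 1 := ⟨r + l.length - 1, by omega⟩
  rw [hpr] at hload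
  obtain ⟨s, γ, hs, hγ, hsat⟩ := canHalt_seek hp (by omega) hload 0 (by omega)
  have e1 : s = (simMachine T q₀ l).init := Fin.ext hs.symm
  have e2 : pos' 0 = ⟨G.source, G.source_mem⟩ := Subtype.ext ((hpos 0 (by omega)).trans h0)
  rw [e1, e2] at hγ
  obtain ⟨ρ, hρ, hmem⟩ := Config.exists_isRun (Config.isInitial_single _) hγ
  exact ⟨G, hG, ρ, hρ, γ, hmem, hsat⟩

/-! ### Computability of the reduction -/

/-- The type of codes of transitions. -/
abbrev TransCode : Type := ℕ × (ℕ × Bool) × Bool × ℕ × Bool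

theorem transCode_injective {s a : ℕ} : Function.Injective (transCode (s := s) (a := a)) := by
  rintro ⟨q, ⟨x, d⟩, b, q', b'⟩ ⟨p, ⟨y, e⟩, c, p', c'⟩ h
  simp only [transCode, Prod.mk.injEq, Fin.val_inj] at h
  obtain ⟨rfl, ⟨rfl, hd⟩, rfl, rfl, rfl⟩ := h
  cases d <;> cases e <;> simp_all [Dir.code]

theorem exists_list_transCode {s a : ℕ}
    (S : Set (Fin s × (Fin a × Dir) × Bool × Fin s × Bool)) (L : List TransCode)
    (h : ∀ x, x ∈ L ↔ ∃ t ∈ S, transCode t = x) :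
    ∃ ts : List (Fin s × (Fin a × Dir) × Bool × Fin s × Bool),
      (∀ t, t ∈ ts ↔ t ∈ S) ∧ ts.map transCode = L := by
  have hL : L ∈ Set.range (List.map (transCode (s := s) (a := a))) := by
    rw [Set.range_list_map]
    intro x hx
    obtain ⟨t, -, rfl⟩ := (h x).1 hx
    exact ⟨t, rfl⟩
  obtain ⟨ts, rfl⟩ := hL
  refine ⟨ts, fun t => ?_, rfl⟩
  rw [← List.mem_map_of_injective transCode_injective, h]
  exact ⟨fun ⟨t', ht', e⟩ => transCode_injective e ▸ ht', fun ht => ⟨t, ht, rfl⟩⟩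

/-- The list need not be computed from `T`, because `T` is fixed in the reduction. -/
theorem exists_list_coreTrans (T : TM0.Machine Bool (Fin (N + 1))) (q₀ : Fin (N + 1)) :
    ∃ L : List TransCode, ∀ x, x ∈ L ↔ ∃ c d b c' b', CoreTrans T q₀ c d b c' b' ∧
      x = (c.code, (0, d.code), b, c'.code, b') := by
  have hfin : {x : TransCode | ∃ c d b c' b', CoreTrans T q₀ c d b c' b' ∧
      x = (c.code, (0, d.code), b, c'.code, b')}.Finite := by
    refine ((Set.finite_Iio (2 * N + 5)).prod (((Set.finite_singleton 0).prod Set.finite_univ).prod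
      (Set.finite_univ.prod ((Set.finite_Iio (2 * N + 5)).prod Set.finite_univ)))).subset ?_
    rintro _ ⟨c, d, b, c', b', h, rfl⟩
    have := h.code_lt
    simpa using this
  exact ⟨hfin.toFinset.toList, fun x => by simp⟩

/-- The list of the codes of the transitions of `simMachine`, given the list `L` of those that do
not depend on the input. -/
def simTransCodes (N : ℕ) (L : List TransCode) (l : List Bool) : List TransCode :=
  L ++ (2 * N + 3, (0, true), false, 2 * N + 4 + l.length, false) ::
    (List.range l.length).map fun j =>
      (2 * N + 4 + (j + 1), (0, false), false, 2 * N + 4 + j, l.getD j false)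

theorem mem_simTransCodes_iff {T : TM0.Machine Bool (Fin (N + 1))} {q₀ : Fin (N + 1)}
    {L : List TransCode} (hL : ∀ x, x ∈ L ↔ ∃ c d b c' b', CoreTrans T q₀ c d b c' b' ∧
      x = (c.code, (0, d.code), b, c'.code, b')) (l : List Bool) (x : TransCode) :
    x ∈ simTransCodes N L l ↔ ∃ t ∈ (simMachine T q₀ l).trans, transCode t = x := by
  have h1 : (∃ t ∈ (simMachine T q₀ l).trans, transCode t = x) ↔ ∃ c d b c' b',
      SimTrans T q₀ l c d b c' b' ∧ x = (c.code, (0, d.code), b, c'.code, b') := by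
    constructor
    · rintro ⟨⟨q, ⟨a, d⟩, b, q', b'⟩, ⟨c, c', ht, hc, hc'⟩, rfl⟩
      obtain rfl : a = 0 := Subsingleton.elim _ _
      exact ⟨c, d, b, c', b', ht, by simp [transCode, hc, hc']⟩
    · rintro ⟨c, d, b, c', b', ht, rfl⟩
      exact ⟨⟨⟨c.code, ht.code_lt.1⟩, (0, d), b, ⟨c'.code, ht.code_lt.2⟩, b'⟩,
        ⟨c, c', ht, rfl, rfl⟩, rfl⟩
  rw [h1, simTransCodes, List.mem_append, List.mem_cons, List.mem_map, hL]
  constructor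
  · rintro (⟨c, d, b, c', b', h, rfl⟩ | rfl | ⟨j, hj, rfl⟩)
    · exact ⟨c, d, b, c', b', .core h, rfl⟩
    · exact ⟨_, _, _, _, _, .enter, rfl⟩
    · exact ⟨_, _, _, _, _, .load j (List.mem_range.1 hj), rfl⟩
  · rintro ⟨c, d, b, c', b', h, rfl⟩
    cases h with
    | core h => exact Or.inl ⟨_, _, _, _, _, h, rfl⟩
    | enter => exact Or.inr (Or.inl rfl)
    | load j hj => exact Or.inr (Or.inr ⟨j, List.mem_range.2 hj, rfl⟩)

/-- The instance of the verification problem that asks whether `T` halts on `l`. -/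
def haltInstance (T : TM0.Machine Bool (Fin (N + 1))) (q₀ : Fin (N + 1)) (l : List Bool) :
    ReachInstance where
  numStates := 2 * N + 5 + l.length
  numLetters := 1
  numVars := 1
  machine := simMachine T q₀ l
  m := 1
  grammar := pathGrammar
  final := haltProperty N l.length

/-- The code of `haltInstance`, given the list `L` of the codes of the core transitions. -/
def haltCode (N : ℕ) (L : List TransCode) (l : List Bool) : ReachCode :=
  ((2 * N + 5 + l.length, 1, 1), (2 * N + 3, simTransCodes N L l), 1,
    (0, [(0, .inr (.inl (0, 0))), (0, .inl 0)]),
    [.inl ((List.range (2 * N + 5 + l.length)).map fun i => if i = 2 * N + 2 then 1 else 0)])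

theorem isCode_haltCode {T : TM0.Machine Bool (Fin (N + 1))} {q₀ : Fin (N + 1)}
    {L : List TransCode} (hL : ∀ x, x ∈ L ↔ ∃ c d b c' b', CoreTrans T q₀ c d b c' b' ∧
      x = (c.code, (0, d.code), b, c'.code, b')) (l : List Bool) :
    (haltInstance T q₀ l).IsCode (haltCode N L l) := by
  obtain ⟨ts, hts, he⟩ := exists_list_transCode _ _ (mem_simTransCodes_iff hL l)
  let rs : List (Fin 1 × SPRhs (Fin 1) (Fin 1)) := [(0, .series 0 0), (0, .terminal 0)]
  have hrs : ∀ r, r ∈ rs ↔ r ∈ pathGrammar.rules := by simp [rs, pathGrammar]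
  refine ⟨ts, rs, hts, hrs, ?_⟩
  have hF : (haltProperty N l.length).code = [.inl ((List.range (2 * N + 5 + l.length)).map
      fun i => if i = 2 * N + 2 then 1 else 0)] := by
    simp only [haltProperty, ConfigProperty.code]
    congr 2
    refine List.ext_getElem (by simp) fun i h1 h2 => ?_
    simp [Fin.ext_iff]
  simp only [haltCode, haltInstance, he, hF]
  rfl

theorem primrec_simTransCodes (N : ℕ) (L : List TransCode) : Primrec (simTransCodes N L) := by
  have hlen : Primrec fun l : List Bool => l.length := Primrec.list_length
  have hadd : ∀ {α : Type} [Primcodable α] (m : ℕ) {g : α → ℕ}, Primrec g →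
      Primrec fun a => m + g a := fun m _ hg => Primrec.nat_add.comp (Primrec.const m) hg
  have hj : Primrec fun p : List Bool × ℕ => p.2 := Primrec.snd
  refine Primrec.list_append.comp (Primrec.const L) (Primrec.list_cons.comp ?_ ?_)
  · exact (Primrec.const _).pair ((Primrec.const _).pair ((Primrec.const _).pair
      ((hadd (2 * N + 4) hlen).pair (Primrec.const _))))
  · refine Primrec.list_map (Primrec.list_range.comp hlen) ?_
    exact (hadd (2 * N + 4) (Primrec.succ.comp hj)).pair ((Primrec.const _).pair
      ((Primrec.const _).pair ((hadd (2 * N + 4) hj).pair (Primrec.list_getD false))))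

theorem primrec_haltCode (N : ℕ) (L : List TransCode) : Primrec (haltCode N L) := by
  have hnum : Primrec fun l : List Bool => 2 * N + 5 + l.length :=
    Primrec.nat_add.comp (Primrec.const _) Primrec.list_length
  refine (hnum.pair (Primrec.const _)).pair (((Primrec.const _).pair
    (primrec_simTransCodes N L)).pair ((Primrec.const _).pair ((Primrec.const _).pair ?_)))
  refine Primrec.list_cons.comp (Primrec.sumInl.comp ?_) (Primrec.const [])
  refine Primrec.list_map (Primrec.list_range.comp hnum) ?_
  exact Primrec.ite (Primrec.eq.comp Primrec.snd (Primrec.const _)) (Primrec.const 1)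
    (Primrec.const 0)

end

/-- The verification problem is undecidable: no computable function answers it correctly on all
codes of instances. -/
theorem mainTheorem3 :
    ¬ ∃ decider : ReachCode → Bool, Computable decider ∧
        ∀ (I : ReachInstance) (c : ReachCode), I.IsCode c → (decider c = true ↔ I.Holds) := by
  rintro ⟨decider, hdec, hcorrect⟩
  obtain ⟨N, T, q₀, tape, htape, hundec⟩ := exists_undecidable_finTM
  obtain ⟨L, hL⟩ := exists_list_coreTrans T q₀
  refine hundec (ComputablePred.computable_iff.2
    ⟨fun c => decider (haltCode N L (tape (Encodable.encode c))), ?_, ?_⟩)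
  · exact hdec.comp ((primrec_haltCode N L).to_comp.comp
      (htape.to_comp.comp Computable.encode))
  · funext c
    have h := hcorrect _ _ (isCode_haltCode hL (tape (Encodable.encode c)))
    exact propext (Iff.trans ⟨reach_of_dom, dom_of_reach⟩ h.symm)
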